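/- Let $\mathfrak g$ be the Lie algebra of a compact connected Lie group, equipped with an invariant inner product; that is, let $\mathfrak g$ be a finite-dimensional real Lie algebra with a positive definite symmetric bilinear form that is invariant under the adjoint action. Let $(e_a)$ be an orthonormal basis of $\mathfrak g$, write $\mu=\sum_a\mu_a e_a$, let $f_{abc}$ be the structure constants, $[e_a,e_b]=\sum_c f_{abc}e_c$, and for a linear operator $A$ on $\mathfrak g$ let $A_{ab}=e_a\cdot A e_b$ be its matrix entries. Let $J(\mu)=\det\big(\tfrac{1-e^{-\mathrm{ad}_\mu}}{\mathrm{ad}_\mu}\big)$ be the Jacobian of the exponential map and let $\mathfrak g_\#=\{\mu\in\mathfrak g: J(\mu)\neq 0\}$ be the set on which the exponential map is a local diffeomorphism. For $\mu\in\mathfrak g_\#$ put $$T_{ab}(\mu)=f(\mathrm{ad}_\mu)_{ab},\qquad f(s)=\frac1s-\frac12\coth\Big(\frac s2\Big),\quad f(0)=0,$$ where $f(\mathrm{ad}_\mu)$ is defined by the functional calculus of the skew-symmetric operator $\mathrm{ad}_\mu$ (after complexification, it acts as $f(z)$ on the $z$-eigenspace of $\mathrm{ad}_\mu$). Then the functions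 $T_{ab}$ are smooth on $\mathfrak g_\#$, and $T$ satisfies the classical dynamical Yang--Baxter equation with coupling constant $1/4$: for all $\mu\in\mathfrak g_\#$ and all indices $a,b,c$, $$\operatorname{Cycl}_{abc}\Big(\frac{\partial T_{bc}}{\partial\mu_a}+\sum_{r,s}T_{ar}f_{rbs}T_{sc}\Big)=\frac14 f_{abc},$$ where $\operatorname{Cycl}_{abc}$ denotes the sum over the cyclic permutations of $(a,b,c)$. -/

import Mathlib

/-- An invariant inner product on a real Lie algebra: a symmetric positive definite bilinear form
`B` with `B ⁅x, y⁆ z = - B y ⁅x, z⁆`. -/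
structure IsInvariantInnerProduct {𝔤 : Type*} [LieRing 𝔤] [LieAlgebra ℝ 𝔤]
    (B : LinearMap.BilinForm ℝ 𝔤) : Prop where
  symm : B.IsSymm
  pos : ∀ x : 𝔤, x ≠ 0 → 0 < B x x
  invariant : B.lieInvariant 𝔤

/-- The function `f(s) = 1/s - (1/2) coth(s/2)`, continued by its limit `f(0) = 0`. -/
noncomputable def dynamicalF (s : ℂ) : ℂ :=
  if s = 0 then 0 else 1 / s - 1 / 2 * (Complex.cosh (s / 2) / Complex.sinh (s / 2))

/-- The entire function `g(s) = (1 - exp(-s))/s`, with `g(0) = 1`. -/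
noncomputable def expJacobianFun (s : ℂ) : ℂ :=
  if s = 0 then 1 else (1 - Complex.exp (-s)) / s

section Calculus

open scoped Matrix.Norms.L2Operator

/-- Functional calculus for a real matrix `A` that is normal, hence unitarily diagonalizable over
`ℂ` (for instance a skew-symmetric matrix), and for `φ` with `φ (conj z) = conj (φ z)`: the matrix
`φ(A)` acts as `φ(z)` on the `z`-eigenspace of `A` in `ℂⁿ`. It has real entries, so that taking
real parts only changes the type of the entries, see `map_ofReal_realMatrixFun`. -/
noncomputable def realMatrixFun {ι : Type*} [Fintype ι] [DecidableEq ι]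
    (φ : ℂ → ℂ) (A : Matrix ι ι ℝ) : Matrix ι ι ℝ :=
  (cfc φ (A.map Complex.ofReal)).map Complex.re

open Polynomial in
theorem map_ofReal_realMatrixFun {ι : Type*} [Fintype ι] [DecidableEq ι]
    (φ : ℂ → ℂ) (hφ : ∀ z, φ (star z) = star (φ z)) (A : Matrix ι ι ℝ)
    (hA : A.transpose = -A) :
    (realMatrixFun φ A).map Complex.ofReal = cfc φ (A.map Complex.ofReal) := by
  classical
  set M : Matrix ι ι ℂ := A.map Complex.ofReal with hM
  have hs : star M = -M := by
    ext i j
    have := congrFun (congrFun hA i) j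
    simp only [Matrix.transpose_apply, Matrix.neg_apply] at this
    simp [hM, Matrix.star_apply, this]
  have hn : IsStarNormal M := ⟨by rw [hs]; exact (Commute.refl M).neg_left⟩
  have hfin : (spectrum ℂ M).Finite := Module.End.finite_spectrum (Matrix.toLin' M) |>.subset (by
    rw [Matrix.spectrum_toLin'])
  -- a skew-Hermitian matrix has purely imaginary spectrum
  have hsk : ∀ z ∈ spectrum ℂ M, star z = -z := by
    have h1 : cfc (fun z : ℂ => star z) M = cfc (fun z : ℂ => -z) M := by
      rw [cfc_star_id (R := ℂ) (a := M), cfc_neg_id (R := ℂ) (a := M), hs]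
    intro z hz
    exact (cfc_eq_cfc_iff_eqOn (R := ℂ) (a := M)).1 h1 hz
  have hneg : ∀ z ∈ spectrum ℂ M, star z ∈ spectrum ℂ M := by
    intro z hz
    rw [hsk z hz]
    have : -M = M.transpose := by
      rw [hM, ← Matrix.transpose_map, hA]; ext; simp
    have h2 : -z ∈ spectrum ℂ (-M) := by
      rw [← spectrum.neg_eq]; simpa using hz
    rw [this] at h2
    rw [spectrum.mem_iff, Matrix.isUnit_iff_isUnit_det] at h2 ⊢
    rw [← Matrix.det_transpose] at h2
    simpa [Matrix.transpose_sub, Matrix.algebraMap_eq_diagonal] using h2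
  obtain ⟨p, hp⟩ : ∃ p : ℂ[X], ∀ z ∈ spectrum ℂ M, p.eval z = φ z :=
    ⟨Lagrange.interpolate hfin.toFinset id φ, fun z hz =>
      Lagrange.eval_interpolate_at_node φ (Set.injOn_id _) (hfin.mem_toFinset.2 hz)⟩
  have key : ∀ q : ℂ[X], (∀ z ∈ spectrum ℂ M, q.eval z = φ z) → cfc φ M = aeval M q := by
    intro q hq
    rw [← cfc_polynomial q M]
    exact cfc_congr fun z hz => (hq z hz).symm
  have hq : ∀ z ∈ spectrum ℂ M, (p.map (starRingEnd ℂ)).eval z = φ z := by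
    intro z hz
    have h3 := Polynomial.hom_eval₂ p (RingHom.id ℂ) (starRingEnd ℂ) (star z)
    rw [← Polynomial.eval, hp _ (hneg z hz), hφ] at h3
    simpa [Polynomial.eval_map] using h3.symm
  have hMc : (starRingEnd ℂ).mapMatrix M = M := by
    ext i j; simp [hM]
  have hX : (starRingEnd ℂ).mapMatrix (cfc φ M) = cfc φ M := by
    conv_rhs => rw [key _ hq]
    rw [key p hp, Polynomial.aeval_def, Polynomial.hom_eval₂, hMc, Polynomial.aeval_def,
      Polynomial.eval₂_map]
    congr 1
    ext z i j
    by_cases hij : i = j <;> simp [Matrix.algebraMap_matrix_apply, hij]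
  ext i j
  have := congrFun (congrFun hX i) j
  simp only [RingHom.mapMatrix_apply, Matrix.map_apply] at this
  exact Complex.conj_eq_iff_re.1 this

end Calculus

section Tensor

variable {𝔤 : Type*} [LieRing 𝔤] [LieAlgebra ℝ 𝔤] {ι : Type*} [Fintype ι] [DecidableEq ι]

/-- The structure constants: `⁅e a, e b⁆ = ∑ c, structConst e a b c • e c`. -/
noncomputable def structConst (e : Module.Basis ι ℝ 𝔤) (a b c : ι) : ℝ :=
  e.repr ⁅e a, e b⁆ c

/-- The matrix `φ(ad μ)` in the basis `e`; its entry at `(a, b)` is the `e a`-component of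
`φ(ad μ) (e b)`. -/
noncomputable def adFun (φ : ℂ → ℂ) (e : Module.Basis ι ℝ 𝔤) (μ : 𝔤) : Matrix ι ι ℝ :=
  realMatrixFun φ (LinearMap.toMatrix e e (LieAlgebra.ad ℝ 𝔤 μ))

/-- The Jacobian `J(μ) = det ((1 - exp(-ad μ)) / ad μ)` of the exponential map. -/
noncomputable def expJacobian (e : Module.Basis ι ℝ 𝔤) (μ : 𝔤) : ℝ :=
  (adFun expJacobianFun e μ).det

/-- The complement of the zero set of the Jacobian of the exponential map: the set on which the
exponential map is a local diffeomorphism. -/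
def expRegularSet (e : Module.Basis ι ℝ 𝔤) : Set 𝔤 :=
  {μ | expJacobian e μ ≠ 0}

/-- The tensor field `T`, with components `T_{ab}(μ) = f(ad μ)_{ab}`. -/
noncomputable def dynamicalT (e : Module.Basis ι ℝ 𝔤) (a b : ι) (μ : 𝔤) : ℝ :=
  adFun dynamicalF e μ a b

/-- The partial derivative `∂F/∂μ_a` at `μ`, in the linear coordinates given by the basis `e`. -/
noncomputable def partialDeriv (e : Module.Basis ι ℝ 𝔤) (a : ι) (F : 𝔤 → ℝ) (μ : 𝔤) : ℝ :=
  lineDeriv ℝ F μ (e a)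

end Tensor

/-- The sum over the cyclic permutations of the three indices. -/
def cyclicSum {ι : Type*} (F : ι → ι → ι → ℝ) (a b c : ι) : ℝ :=
  F a b c + F b c a + F c a b

open Filter Topology

/-- The coefficients `(-1)^n / (n + k)!` of the entire function `phiSeries k`. -/
noncomputable def phiCoeff (k n : ℕ) : ℝ := (-1) ^ n / ((n + k).factorial : ℝ)

/-- The entire function `a ↦ ∑ n, (-a)^n / (n + k)!`, on a Banach algebra. For `k = 0, 1, 2` it is
`exp (-a)`, `(1 - exp (-a)) / a` and `(exp (-a) - 1 + a) / a²`. -/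
noncomputable def phiSeries {𝔸 : Type*} [NormedRing 𝔸] [NormedAlgebra ℝ 𝔸] (k : ℕ) : 𝔸 → 𝔸 :=
  FormalMultilinearSeries.ofScalarsSum (phiCoeff k)

theorem phiCoeff_ne_zero (k n : ℕ) : phiCoeff k n ≠ 0 := by
  unfold phiCoeff; positivity

theorem abs_phiCoeff (k n : ℕ) : |phiCoeff k n| = 1 / ((n + k).factorial : ℝ) := by
  simp [phiCoeff, abs_div]

theorem phiCoeff_succ (k n : ℕ) : phiCoeff k (n + 1) = -phiCoeff (k + 1) n := by
  rw [phiCoeff, phiCoeff, show n + 1 + k = n + (k + 1) by ring]; ring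

theorem phiCoeff_eq_mul (k n : ℕ) : phiCoeff k n = (n + k + 1) * phiCoeff (k + 1) n := by
  rw [phiCoeff, phiCoeff, show n + (k + 1) = (n + k) + 1 by ring, Nat.factorial_succ]
  push_cast
  field_simp

theorem succ_mul_phiCoeff_succ (k n : ℕ) :
    ((n : ℝ) + 1) * phiCoeff k (n + 1) = k * phiCoeff (k + 1) n - phiCoeff k n := by
  rw [phiCoeff_succ, phiCoeff_eq_mul k n]; ring

theorem summable_mul_abs_phiCoeff_mul_pow (k : ℕ) (R : ℝ) (hR : 0 ≤ R) :
    Summable fun n : ℕ => |phiCoeff k n| * (n * R ^ (n - 1)) := by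
  rw [← summable_nat_add_iff 1]
  refine Summable.of_nonneg_of_le (fun n => by positivity) (fun n => ?_)
    (Real.summable_pow_div_factorial R)
  rw [abs_phiCoeff, Nat.add_sub_cancel, div_mul_eq_mul_div, one_mul,
    div_le_div_iff₀ (by positivity) (by positivity)]
  have h : ((n + 1 : ℕ) : ℝ) * (n.factorial : ℝ) ≤ ((n + 1 + k).factorial : ℝ) := by
    rw [← Nat.cast_mul, ← Nat.factorial_succ]
    exact_mod_cast Nat.factorial_le (by omega)
  calc _ = R ^ n * (((n + 1 : ℕ) : ℝ) * (n.factorial : ℝ)) := by ring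
    _ ≤ _ := by gcongr

section Algebra

variable {𝔸 : Type*} [NormedRing 𝔸] [NormedAlgebra ℝ 𝔸]

theorem radius_ofScalars_phiCoeff (k : ℕ) :
    (FormalMultilinearSeries.ofScalars 𝔸 (phiCoeff k)).radius = ⊤ := by
  refine FormalMultilinearSeries.ofScalars_radius_eq_top_of_tendsto 𝔸 _
    (Eventually.of_forall (phiCoeff_ne_zero k)) ?_
  have h : ∀ n : ℕ, ‖phiCoeff k n.succ‖ / ‖phiCoeff k n‖ = 1 / (((n + k : ℕ) : ℝ) + 1) := by
    intro n
    rw [Real.norm_eq_abs, Real.norm_eq_abs, abs_phiCoeff, abs_phiCoeff,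
      show n.succ + k = (n + k) + 1 by omega, Nat.factorial_succ]
    push_cast
    field_simp
  simp_rw [h]
  exact tendsto_one_div_add_atTop_nhds_zero_nat.comp (tendsto_add_atTop_nat k)

variable [CompleteSpace 𝔸]

theorem hasFPowerSeriesOnBall_phiSeries (k : ℕ) :
    HasFPowerSeriesOnBall (phiSeries k : 𝔸 → 𝔸)
      (FormalMultilinearSeries.ofScalars 𝔸 (phiCoeff k)) 0 ⊤ := by
  have := (FormalMultilinearSeries.ofScalars 𝔸 (phiCoeff k)).hasFPowerSeriesOnBall
    (by rw [radius_ofScalars_phiCoeff]; exact ENNReal.zero_lt_top)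
  rwa [radius_ofScalars_phiCoeff] at this

theorem hasSum_phiSeries (k : ℕ) (a : 𝔸) :
    HasSum (fun n => phiCoeff k n • a ^ n) (phiSeries k a) := by
  have := (hasFPowerSeriesOnBall_phiSeries (𝔸 := 𝔸) k).hasSum (y := a) (by simp)
  simpa [FormalMultilinearSeries.ofScalars_apply_eq] using this

theorem contDiff_phiSeries (k : ℕ) {n : WithTop ℕ∞} : ContDiff ℝ n (phiSeries k : 𝔸 → 𝔸) := by
  rw [contDiff_iff_contDiffAt]
  intro a
  exact ((hasFPowerSeriesOnBall_phiSeries k).analyticAt_of_mem (by simp)).contDiffAt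

theorem phiSeries_eq_sub (k : ℕ) (a : 𝔸) :
    phiSeries k a = (1 / (k.factorial : ℝ)) • (1 : 𝔸) - a * phiSeries (k + 1) a := by
  have h1 := (hasSum_phiSeries k a)
  rw [← hasSum_nat_add_iff' 1] at h1
  have h2 := ((hasSum_phiSeries (k + 1) a).mul_left a).neg
  have h3 := h1.unique (h2.congr_fun fun n => ?_)
  · simp only [Finset.sum_range_one, phiCoeff, pow_zero, Nat.zero_add] at h3
    rw [sub_eq_iff_eq_add] at h3
    rw [h3]; abel
  · rw [phiCoeff_succ, pow_succ', neg_smul, mul_smul_comm]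

theorem hasSum_deriv_phiSeries (k : ℕ) (a : 𝔸) :
    HasSum (fun n : ℕ => phiCoeff k n • ((n : ℝ) • a ^ (n - 1)))
      ((k : ℝ) • phiSeries (k + 1) a - phiSeries k a) := by
  rw [← hasSum_nat_add_iff' 1]
  simp only [Finset.sum_range_one, Nat.cast_zero, zero_smul, smul_zero, sub_zero,
    Nat.add_sub_cancel]
  refine (((hasSum_phiSeries (k + 1) a).const_smul (k : ℝ)).sub (hasSum_phiSeries k a)).congr_fun
    fun n => ?_
  rw [smul_smul, smul_smul, ← sub_smul, ← succ_mul_phiCoeff_succ, mul_comm]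
  push_cast; rfl

theorem norm_sum_pow_mul_mul_pow_le {𝔸 : Type*} [NormedRing 𝔸] [NormOneClass 𝔸] {R : ℝ} (b x : 𝔸)
    (hb : ‖b‖ ≤ R) (n : ℕ) :
    ‖∑ i ∈ Finset.range n, b ^ (n.pred - i) * x * b ^ i‖ ≤ n * R ^ (n - 1) * ‖x‖ := by
  have hR0 : 0 ≤ R := (norm_nonneg b).trans hb
  have hsum : ∑ _i ∈ Finset.range n, R ^ (n - 1) * ‖x‖ = n * R ^ (n - 1) * ‖x‖ := by
    rw [Finset.sum_const, Finset.card_range, nsmul_eq_mul, mul_assoc]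
  rw [← hsum]
  refine norm_sum_le_of_le _ fun i hi => ?_
  have hi' : n - 1 = (n.pred - i) + i := by
    have := Finset.mem_range.1 hi
    simp only [Nat.pred_eq_sub_one]; omega
  calc _ ≤ ‖b‖ ^ (n.pred - i) * ‖x‖ * ‖b‖ ^ i :=
        (norm_mul_le _ _).trans (mul_le_mul ((norm_mul_le _ _).trans
          (mul_le_mul_of_nonneg_right (norm_pow_le _ _) (norm_nonneg _))) (norm_pow_le _ _)
          (norm_nonneg _) (by positivity))
    _ ≤ R ^ (n.pred - i) * ‖x‖ * R ^ i := by gcongr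
    _ = _ := by rw [hi', pow_add]; ring

theorem hasDerivAt_phiSeries_line [NormOneClass 𝔸] (k : ℕ) (a x : 𝔸) :
    ∃ d : 𝔸, HasSum (fun n : ℕ => phiCoeff k n •
        ∑ i ∈ Finset.range n, a ^ (n.pred - i) * x * a ^ i) d ∧
      HasDerivAt (fun t : ℝ => phiSeries k (a + t • x)) d 0 := by
  set R : ℝ := ‖a‖ + ‖x‖ with hR
  have hus : Summable fun n : ℕ => |phiCoeff k n| * (n * R ^ (n - 1) * ‖x‖) := by
    simpa only [mul_assoc] using
      (summable_mul_abs_phiCoeff_mul_pow k R (by positivity)).mul_right ‖x‖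
  have hline : ∀ t : ℝ, HasDerivAt (fun t : ℝ => a + t • x) x t := fun t => by
    simpa using ((hasDerivAt_id t).smul_const x).const_add a
  have hbound : ∀ n : ℕ, ∀ t ∈ Set.Ioo (-1 : ℝ) 1, ‖phiCoeff k n •
      ∑ i ∈ Finset.range n, (a + t • x) ^ (n.pred - i) * x * (a + t • x) ^ i‖ ≤
        |phiCoeff k n| * (n * R ^ (n - 1) * ‖x‖) := by
    intro n t ht
    rw [norm_smul, Real.norm_eq_abs]
    refine mul_le_mul_of_nonneg_left (norm_sum_pow_mul_mul_pow_le _ x ?_ n) (abs_nonneg _)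
    refine (norm_add_le _ _).trans (add_le_add_right ?_ _)
    rw [norm_smul]
    exact mul_le_of_le_one_left (norm_nonneg _) (abs_le.2 ⟨ht.1.le, ht.2.le⟩)
  have h0 : (0 : ℝ) ∈ Set.Ioo (-1 : ℝ) 1 := by norm_num
  have hd := hasDerivAt_tsum_of_isPreconnected hus isOpen_Ioo isPreconnected_Ioo
    (fun n t _ => ((hline t).fun_pow' n).const_smul (phiCoeff k n)) hbound h0
    (hasSum_phiSeries k _).summable h0
  have ht : (fun t : ℝ => phiSeries k (a + t • x)) =
      fun t : ℝ => ∑' n, phiCoeff k n • (a + t • x) ^ n :=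
    funext fun t => (hasSum_phiSeries k _).tsum_eq.symm
  have hs := (Summable.of_norm_bounded hus fun n => hbound n 0 h0).hasSum
  simp only [zero_smul, add_zero] at hs hd
  rw [ht]
  exact ⟨_, hs, hd⟩

end Algebra

section Scalar

theorem phiSeries_zero_eq_exp (z : ℂ) : phiSeries 0 z = Complex.exp (-z) := by
  have h := NormedSpace.expSeries_div_hasSum_exp (𝔸 := ℂ) (-z)
  rw [← Complex.exp_eq_exp_ℂ] at h
  refine (hasSum_phiSeries 0 z).unique (h.congr_fun fun n => ?_)
  rw [phiCoeff, Complex.real_smul, neg_pow z]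
  push_cast
  simp only [add_zero]
  ring

theorem phiSeries_eq_sub_mul (k : ℕ) (z : ℂ) :
    phiSeries k z = 1 / (k.factorial : ℂ) - z * phiSeries (k + 1) z := by
  rw [phiSeries_eq_sub k z, Complex.real_smul]
  push_cast
  ring

theorem mul_phiSeries_one (z : ℂ) : z * phiSeries 1 z = 1 - Complex.exp (-z) := by
  have := phiSeries_eq_sub_mul 0 z
  rw [phiSeries_zero_eq_exp] at this
  simp only [Nat.factorial_zero, Nat.cast_one, div_one, zero_add] at this
  linear_combination this

theorem mul_phiSeries_two (z : ℂ) : z * phiSeries 2 z = 1 - phiSeries 1 z := by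
  have := phiSeries_eq_sub_mul 1 z
  simp only [Nat.factorial_one, Nat.cast_one, div_one, Nat.reduceAdd] at this
  linear_combination this

theorem mul_phiSeries_three (z : ℂ) : z * phiSeries 3 z = 1 / 2 - phiSeries 2 z := by
  have := phiSeries_eq_sub_mul 2 z
  simp only [Nat.factorial_two, Nat.cast_ofNat, Nat.reduceAdd] at this
  linear_combination this

theorem phiSeries_apply_zero (k : ℕ) : phiSeries k (0 : ℂ) = 1 / (k.factorial : ℂ) := by
  rw [phiSeries_eq_sub_mul]; simp

theorem expJacobianFun_eq_phiSeries (z : ℂ) : expJacobianFun z = phiSeries 1 z := by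
  rw [expJacobianFun]
  split_ifs with h
  · subst h; rw [phiSeries_apply_zero]; simp
  · rw [← mul_phiSeries_one, mul_div_cancel_left₀ _ h]

theorem dynamicalF_zero : dynamicalF 0 = 0 := if_pos rfl

theorem dynamicalF_neg (z : ℂ) : dynamicalF (-z) = -dynamicalF z := by
  simp only [dynamicalF, neg_eq_zero]
  split_ifs with h
  · simp
  · rw [neg_div, Complex.cosh_neg, Complex.sinh_neg]; ring

theorem dynamicalF_eq_exp {z : ℂ} (hz : z ≠ 0) (h : 1 - Complex.exp (-z) ≠ 0) :
    dynamicalF z =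
      1 / z - 1 / 2 * ((1 + Complex.exp (-z)) / (1 - Complex.exp (-z))) := by
  rw [dynamicalF, if_neg hz]
  have hE : Complex.exp (-(z / 2)) ≠ 0 := Complex.exp_ne_zero _
  have h1 : Complex.exp (-z) = Complex.exp (-(z / 2)) ^ 2 := by
    rw [← Complex.exp_nat_mul]; congr 1; push_cast; ring
  have h2 : Complex.exp (z / 2) = (Complex.exp (-(z / 2)))⁻¹ := by
    rw [← Complex.exp_neg, neg_neg]
  rw [Complex.cosh, Complex.sinh, h2, h1]
  rw [h1] at h
  have h3 : (Complex.exp (-(z / 2)))⁻¹ - Complex.exp (-(z / 2)) ≠ 0 := by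
    intro h4
    apply h
    field_simp at h4
    simpa using h4
  congr 2
  rw [div_div_div_cancel_right₀ two_ne_zero, div_eq_div_iff h3 h]
  field_simp

theorem dynamicalF_eq_phiSeries {z : ℂ} (h : phiSeries 1 z ≠ 0) :
    dynamicalF z = 1 / 2 - phiSeries 2 z / phiSeries 1 z := by
  by_cases hz : z = 0
  · subst hz
    rw [dynamicalF_zero, phiSeries_apply_zero, phiSeries_apply_zero]
    norm_num
  · have h1 := mul_phiSeries_one z
    have h2 := mul_phiSeries_two z
    have h3 : 1 - Complex.exp (-z) ≠ 0 := h1 ▸ mul_ne_zero hz h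
    rw [dynamicalF_eq_exp hz h3, ← h1,
      show Complex.exp (-z) = 1 - z * phiSeries 1 z by rw [h1]; ring]
    field_simp
    linear_combination 2 * h2

/-- The divided difference `(f l - f r) / (l - r)` of `f = dynamicalF`, continued to the diagonal by
`f' = f ^ 2 - 1 / 4 - 2 * f / s`, which is `-1 / 12` at `s = 0`. -/
noncomputable def dynamicalFDiff (l r : ℂ) : ℂ :=
  if l = r then
    if r = 0 then -1 / 12 else dynamicalF r ^ 2 - 1 / 4 - 2 * dynamicalF r / r
  else (dynamicalF l - dynamicalF r) / (l - r)

/-- The divided differences of `phiSeries k`. -/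
noncomputable def phiDiff (k : ℕ) (l r : ℂ) : ℂ :=
  if l = r then k * phiSeries (k + 1) r - phiSeries k r
  else (phiSeries k l - phiSeries k r) / (l - r)

theorem hasSum_phiDiff (k : ℕ) (l r : ℂ) :
    HasSum (fun n : ℕ => (phiCoeff k n : ℂ) * ∑ i ∈ Finset.range n, l ^ (n.pred - i) * r ^ i)
      (phiDiff k l r) := by
  rw [phiDiff]
  split_ifs with h
  · subst h
    have := hasSum_deriv_phiSeries k l
    simp only [Complex.real_smul, Complex.ofReal_natCast] at this
    refine this.congr_fun fun n => ?_
    have hc : ∀ i ∈ Finset.range n, l ^ (n.pred - i) * l ^ i = l ^ (n - 1) := by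
      intro i hi
      have := Finset.mem_range.1 hi
      rw [← pow_add]; congr 1; simp only [Nat.pred_eq_sub_one]; omega
    rw [Finset.sum_congr rfl hc, Finset.sum_const, Finset.card_range, nsmul_eq_mul]
  · have hlr : l - r ≠ 0 := sub_ne_zero.2 h
    refine (((hasSum_phiSeries k l).sub (hasSum_phiSeries k r)).div_const (l - r)).congr_fun
      fun n => ?_
    rw [eq_div_iff hlr, Complex.real_smul, Complex.real_smul, ← mul_sub, mul_assoc]
    congr 1
    have h1 := (Commute.all r l).mul_geom_sum₂ n
    have h2 : ∑ i ∈ Finset.range n, l ^ (n.pred - i) * r ^ i =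
        ∑ i ∈ Finset.range n, r ^ i * l ^ (n - 1 - i) :=
      Finset.sum_congr rfl fun i _ => mul_comm _ _
    rw [h2]
    linear_combination -h1

theorem dynamicalFDiff_mul {l r : ℂ} (hl : phiSeries 1 l ≠ 0) (hr : phiSeries 1 r ≠ 0) :
    dynamicalFDiff l r * phiSeries 1 r + dynamicalF l * phiDiff 1 l r =
      1 / 2 * phiDiff 1 l r - phiDiff 2 l r := by
  rw [dynamicalFDiff, phiDiff, phiDiff]
  split_ifs with h h0
  · subst h0; subst h
    simp only [dynamicalF_zero, phiSeries_apply_zero]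
    norm_num [Nat.factorial]
  · subst h
    have h2 := mul_phiSeries_two l
    have h3 := mul_phiSeries_three l
    rw [dynamicalF_eq_phiSeries hl]
    have h3' : phiSeries 3 l = (1 / 2 - phiSeries 2 l) / l := by
      rw [← h3, mul_div_cancel_left₀ _ h0]
    have h2' : phiSeries 1 l = 1 - l * phiSeries 2 l := by rw [h2]; ring
    rw [show 2 + 1 = 3 by rfl, show 1 + 1 = 2 by rfl, h3']
    field_simp
    push_cast
    rw [h2']
    ring
  · rw [dynamicalF_eq_phiSeries hl, dynamicalF_eq_phiSeries hr]
    have hlr : l - r ≠ 0 := sub_ne_zero.2 h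
    field_simp
    ring

theorem phiSeries_one_neg {z : ℂ} (h : phiSeries 1 z ≠ 0) : phiSeries 1 (-z) ≠ 0 := by
  by_cases hz : z = 0
  · simpa [hz] using h
  · intro h0
    have h1 := mul_phiSeries_one z
    have h2 := mul_phiSeries_one (-z)
    rw [h0, mul_zero, neg_neg, eq_comm, sub_eq_zero] at h2
    rw [Complex.exp_neg, ← h2, inv_one, sub_self] at h1
    exact h ((mul_eq_zero.1 h1).resolve_left hz)

theorem cyclic_dynamicalFDiff_of_zero {b c : ℂ} (h : b + c = 0) :
    dynamicalFDiff (-b) c + dynamicalFDiff (-c) 0 + dynamicalFDiff (-0) b +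
      (dynamicalF 0 * dynamicalF c + dynamicalF b * dynamicalF 0 +
        dynamicalF c * dynamicalF b) = -(1 / 4) := by
  obtain rfl : b = -c := eq_neg_of_add_eq_zero_left h
  by_cases hc : c = 0
  · subst hc
    simp [dynamicalFDiff, dynamicalF_zero]; norm_num
  · simp only [dynamicalFDiff, neg_neg, neg_zero, if_true, hc, if_false, neg_eq_zero,
      dynamicalF_zero, dynamicalF_neg, if_neg (Ne.symm (neg_ne_zero.2 hc)),
      sub_zero, zero_sub, neg_neg, zero_mul, mul_zero, add_zero, neg_div_neg_eq]
    ring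

theorem cyclic_dynamicalFDiff {a b c : ℂ} (h : a + b + c = 0) (ha : phiSeries 1 a ≠ 0)
    (hb : phiSeries 1 b ≠ 0) (hc : phiSeries 1 c ≠ 0) :
    dynamicalFDiff (-b) c + dynamicalFDiff (-c) a + dynamicalFDiff (-a) b +
      (dynamicalF a * dynamicalF c + dynamicalF b * dynamicalF a +
        dynamicalF c * dynamicalF b) = -(1 / 4) := by
  by_cases ha0 : a = 0
  · subst ha0
    exact cyclic_dynamicalFDiff_of_zero (by simpa using h)
  by_cases hb0 : b = 0
  · subst hb0
    have := cyclic_dynamicalFDiff_of_zero (b := c) (c := a) (by linear_combination h)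
    linear_combination this
  by_cases hc0 : c = 0
  · subst hc0
    have := cyclic_dynamicalFDiff_of_zero (b := a) (c := b) (by linear_combination h)
    linear_combination this
  have e1 : ∀ {x : ℂ}, x ≠ 0 → phiSeries 1 x ≠ 0 → 1 - Complex.exp (-x) ≠ 0 := fun hx h =>
    mul_phiSeries_one _ ▸ mul_ne_zero hx h
  have d1 : -b ≠ c := fun h' => ha0 (by linear_combination h + h')
  have d2 : -c ≠ a := fun h' => hb0 (by linear_combination h + h')
  have d3 : -a ≠ b := fun h' => hc0 (by linear_combination h + h')
  rw [dynamicalFDiff, dynamicalFDiff, dynamicalFDiff, if_neg d1, if_neg d2, if_neg d3,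
    dynamicalF_neg, dynamicalF_neg, dynamicalF_neg, show -b - c = a by linear_combination -h,
    show -c - a = b by linear_combination -h, show -a - b = c by linear_combination -h,
    dynamicalF_eq_exp ha0 (e1 ha0 ha), dynamicalF_eq_exp hb0 (e1 hb0 hb),
    dynamicalF_eq_exp hc0 (e1 hc0 hc)]
  have hE : Complex.exp (-a) * Complex.exp (-b) * Complex.exp (-c) = 1 := by
    rw [← Complex.exp_add, ← Complex.exp_add, show -a + -b + -c = 0 by linear_combination -h,
      Complex.exp_zero]
  have xa := e1 ha0 ha
  have xb := e1 hb0 hb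
  have xc := e1 hc0 hc
  generalize Complex.exp (-a) = p at *
  generalize Complex.exp (-b) = q at *
  generalize Complex.exp (-c) = r at *
  have key : (1 + p) / (1 - p) * ((1 + q) / (1 - q)) + (1 + q) / (1 - q) * ((1 + r) / (1 - r)) +
      (1 + r) / (1 - r) * ((1 + p) / (1 - p)) = -1 := by
    field_simp
    linear_combination -4 * hE
  generalize (1 + p) / (1 - p) = u at *
  generalize (1 + q) / (1 - q) = v at *
  generalize (1 + r) / (1 - r) = w at *
  have hca : c = -a - b := by linear_combination h
  have k2 : 1 / (a * c) + 1 / (a * b) + 1 / (b * c) = 0 := by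
    field_simp
    linear_combination h
  linear_combination (1 / 4) * key - k2
end Scalar

section MatrixCalculus

open scoped Matrix.Norms.L2Operator
open Matrix

theorem star_map_ofReal_of_transpose_eq_neg {ι : Type*} {A : Matrix ι ι ℝ} (hA : A.transpose = -A) :
    star (A.map Complex.ofReal) = -A.map Complex.ofReal := by
  ext i j
  have := congrFun (congrFun hA i) j
  simp only [Matrix.transpose_apply, Matrix.neg_apply] at this
  simp [Matrix.star_apply, this]

theorem map_ofReal_injective {ι : Type*} {A A' : Matrix ι ι ℝ}
    (h : A.map Complex.ofReal = A'.map Complex.ofReal) : A = A' :=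
  Matrix.map_injective Complex.ofReal_injective h

variable {ι : Type*} [Fintype ι]

/-- The real-linear functional `d ↦ y · d z` on real matrices, for complex vectors `y`, `z`. -/
noncomputable def sandwich (y z : ι → ℂ) : Matrix ι ι ℝ →ₗ[ℝ] ℂ where
  toFun d := y ⬝ᵥ (d.map Complex.ofReal *ᵥ z)
  map_add' d d' := by
    rw [Matrix.map_add _ Complex.ofReal_add, Matrix.add_mulVec, dotProduct_add]
  map_smul' c d := by
    rw [show (c • d).map Complex.ofReal = (c : ℂ) • d.map Complex.ofReal by ext; simp,
      Matrix.smul_mulVec, dotProduct_smul]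
    simp

theorem sandwich_apply (y z : ι → ℂ) (d : Matrix ι ι ℝ) :
    sandwich y z d = y ⬝ᵥ (d.map Complex.ofReal *ᵥ z) := rfl

theorem map_ofReal_mul (A A' : Matrix ι ι ℝ) :
    (A * A').map Complex.ofReal = A.map Complex.ofReal * A'.map Complex.ofReal :=
  Matrix.map_mul (f := Complex.ofRealHom)

theorem sandwich_mul (y z : ι → ℂ) (A A' : Matrix ι ι ℝ) :
    sandwich y z (A * A') = sandwich y (A'.map Complex.ofReal *ᵥ z) A := by
  rw [sandwich_apply, sandwich_apply, map_ofReal_mul, Matrix.mulVec_mulVec]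

theorem sandwich_mul' (y z : ι → ℂ) (A A' : Matrix ι ι ℝ) :
    sandwich y z (A * A') = sandwich (y ᵥ* A.map Complex.ofReal) z A' := by
  rw [sandwich_apply, sandwich_apply, map_ofReal_mul, ← Matrix.mulVec_mulVec,
    Matrix.dotProduct_mulVec]

theorem sandwich_smul_right (y z : ι → ℂ) (c : ℂ) (A : Matrix ι ι ℝ) :
    sandwich y (c • z) A = c * sandwich y z A := by
  simp [sandwich_apply, Matrix.mulVec_smul]

theorem sandwich_smul_left (y z : ι → ℂ) (c : ℂ) (A : Matrix ι ι ℝ) :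
    sandwich (c • y) z A = c * sandwich y z A := by
  simp [sandwich_apply]

theorem HasSum.sandwich {f : ℕ → Matrix ι ι ℝ} {d : Matrix ι ι ℝ} (h : HasSum f d) (y z : ι → ℂ) :
    HasSum (fun n => sandwich y z (f n)) (sandwich y z d) :=
  h.mapL (LinearMap.toContinuousLinearMap (_root_.sandwich y z))

theorem vecMul_of_eigenvector {A : Matrix ι ι ℝ} (hA : A.transpose = -A) {v : ι → ℂ} {r : ℂ}
    (h : A.map Complex.ofReal *ᵥ v = r • v) : v ᵥ* A.map Complex.ofReal = (-r) • v := by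
  rw [← Matrix.mulVec_transpose, ← Matrix.transpose_map, hA, Matrix.map_neg _ Complex.ofReal_neg,
    Matrix.neg_mulVec, h, neg_smul]

theorem isStarNormal_map_ofReal_of_transpose_eq_neg {A : Matrix ι ι ℝ} (hA : A.transpose = -A) :
    IsStarNormal (A.map Complex.ofReal) :=
  ⟨by rw [star_map_ofReal_of_transpose_eq_neg hA]; exact (Commute.refl _).neg_left⟩

variable [DecidableEq ι]

theorem exists_eigenbasis_of_transpose_eq_neg {A : Matrix ι ι ℝ} (hA : A.transpose = -A) :
    ∃ (b : Module.Basis ι ℂ (ι → ℂ)) (l : ι → ℂ),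
      ∀ i, A.map Complex.ofReal *ᵥ b i = l i • b i := by
  have hH : (Complex.I • A.map Complex.ofReal).IsHermitian := by
    rw [Matrix.IsHermitian, Matrix.conjTranspose_smul, ← Matrix.star_eq_conjTranspose,
      star_map_ofReal_of_transpose_eq_neg hA]
    simp
  refine ⟨hH.eigenvectorBasis.toBasis.map (WithLp.linearEquiv 2 ℂ (ι → ℂ)),
    fun i => -Complex.I * hH.eigenvalues i, fun i => ?_⟩
  have h := hH.mulVec_eigenvectorBasis i
  rw [Matrix.smul_mulVec] at h
  have h2 := congrArg (fun v => -Complex.I • v) h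
  simp only [smul_smul, neg_mul, Complex.I_mul_I, neg_neg, one_smul] at h2
  simp only [Module.Basis.map_apply, OrthonormalBasis.coe_toBasis, WithLp.linearEquiv_apply]
  refine h2.trans ?_
  ext j
  simp [mul_assoc]

theorem Matrix.ext_mulVec_basis {κ : Type*} (b : Module.Basis κ ℂ (ι → ℂ)) {P Q : Matrix ι ι ℂ}
    (h : ∀ i, P *ᵥ b i = Q *ᵥ b i) : P = Q := by
  apply Matrix.toLin'.injective
  exact b.ext fun i => by simpa using h i

theorem Matrix.pow_mulVec_of_eigenvector {M : Matrix ι ι ℂ} {v : ι → ℂ} {r : ℂ} (h : M *ᵥ v = r • v)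
    (n : ℕ) : (M ^ n) *ᵥ v = r ^ n • v := by
  induction n with
  | zero => simp
  | succ n ih => rw [pow_succ, ← Matrix.mulVec_mulVec, h, Matrix.mulVec_smul, ih, smul_smul,
      pow_succ']

theorem Matrix.vecMul_pow_of_eigenvector {M : Matrix ι ι ℂ} {v : ι → ℂ} {r : ℂ}
    (h : v ᵥ* M = r • v) (n : ℕ) : v ᵥ* (M ^ n) = r ^ n • v := by
  induction n with
  | zero => simp
  | succ n ih => rw [pow_succ', ← Matrix.vecMul_vecMul, h, Matrix.smul_vecMul, ih, smul_smul,
      pow_succ']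

open Polynomial in
theorem Matrix.aeval_mulVec_of_eigenvector {M : Matrix ι ι ℂ} {v : ι → ℂ} {r : ℂ}
    (h : M *ᵥ v = r • v) (p : ℂ[X]) : (aeval M p) *ᵥ v = p.eval r • v := by
  induction p using Polynomial.induction_on' with
  | add p q hp hq => rw [map_add, Matrix.add_mulVec, hp, hq, eval_add, add_smul]
  | monomial n a =>
    rw [aeval_monomial, Algebra.algebraMap_eq_smul_one, smul_mul_assoc, one_mul, Matrix.smul_mulVec,
      Matrix.pow_mulVec_of_eigenvector h, eval_monomial, smul_smul]

theorem Matrix.mem_spectrum_of_eigenvector {M : Matrix ι ι ℂ} {v : ι → ℂ} {r : ℂ}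
    (h : M *ᵥ v = r • v) (hv : v ≠ 0) : r ∈ spectrum ℂ M := by
  rw [← Matrix.spectrum_toLin']
  refine Module.End.HasEigenvalue.mem_spectrum
    (Module.End.hasEigenvalue_of_hasEigenvector (x := v) ⟨?_, hv⟩)
  rw [Module.End.mem_eigenspace_iff, Matrix.toLin'_apply, h]

theorem cfc_mulVec_of_eigenvector {M : Matrix ι ι ℂ} (hM : IsStarNormal M) {v : ι → ℂ} {r : ℂ}
    (h : M *ᵥ v = r • v) (φ : ℂ → ℂ) : cfc φ M *ᵥ v = φ r • v := by
  by_cases hv : v = 0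
  · simp [hv]
  have hfin : (spectrum ℂ M).Finite := Module.End.finite_spectrum (Matrix.toLin' M) |>.subset (by
    rw [Matrix.spectrum_toLin'])
  have hp : ∀ z ∈ spectrum ℂ M, (Lagrange.interpolate hfin.toFinset id φ).eval z = φ z :=
    fun z hz => Lagrange.eval_interpolate_at_node φ (Set.injOn_id _) (hfin.mem_toFinset.2 hz)
  rw [← hp r (Matrix.mem_spectrum_of_eigenvector h hv), ← Matrix.aeval_mulVec_of_eigenvector h,
    ← cfc_polynomial _ M]
  congr 1
  exact cfc_congr fun z hz => (hp z hz).symm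

theorem map_ofReal_pow (A : Matrix ι ι ℝ) (n : ℕ) :
    (A ^ n).map Complex.ofReal = A.map Complex.ofReal ^ n :=
  Matrix.map_pow (f := Complex.ofRealHom) A n

theorem phiSeries_map_mulVec_of_eigenvector {A : Matrix ι ι ℝ} {v : ι → ℂ} {r : ℂ}
    (h : A.map Complex.ofReal *ᵥ v = r • v) (k : ℕ) :
    (phiSeries k A).map Complex.ofReal *ᵥ v = phiSeries k r • v := by
  ext i
  have h1 := (hasSum_phiSeries k A).sandwich (Pi.single i 1) v
  have h2 := (hasSum_phiSeries k r).mul_right (v i)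
  rw [sandwich_apply, single_one_dotProduct] at h1
  refine h1.unique (h2.congr_fun fun n => ?_)
  rw [map_smul, sandwich_apply, map_ofReal_pow, Matrix.pow_mulVec_of_eigenvector h,
    single_one_dotProduct]
  simp [mul_assoc]

theorem sandwich_phiSeries_deriv {A X d : Matrix ι ι ℝ} {y z : ι → ℂ} {l r : ℂ} {k : ℕ}
    (hy : y ᵥ* A.map Complex.ofReal = l • y) (hz : A.map Complex.ofReal *ᵥ z = r • z)
    (hd : HasSum (fun n : ℕ => phiCoeff k n •
        ∑ i ∈ Finset.range n, A ^ (n.pred - i) * X * A ^ i) d) :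
    sandwich y z d = phiDiff k l r * sandwich y z X := by
  refine (hd.sandwich y z).unique (((hasSum_phiDiff k l r).mul_right _).congr_fun fun n => ?_)
  rw [map_smul, map_sum, Complex.real_smul, mul_assoc, Finset.sum_mul]
  congr 1
  refine Finset.sum_congr rfl fun i _ => ?_
  rw [sandwich_mul, map_ofReal_pow, Matrix.pow_mulVec_of_eigenvector hz, sandwich_smul_right,
    sandwich_mul', map_ofReal_pow, Matrix.vecMul_pow_of_eigenvector hy, sandwich_smul_left]
  ring

theorem expJacobianFun_star (z : ℂ) : expJacobianFun (star z) = star (expJacobianFun z) := by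
  simp only [expJacobianFun, star_eq_zero]
  split_ifs <;> simp [← Complex.exp_conj]

theorem dynamicalF_star (z : ℂ) : dynamicalF (star z) = star (dynamicalF z) := by
  simp only [dynamicalF, star_eq_zero]
  split_ifs <;> simp [← Complex.cosh_conj, ← Complex.sinh_conj, map_ofNat]

theorem realMatrixFun_mulVec_of_eigenvector {φ : ℂ → ℂ} (hφ : ∀ z, φ (star z) = star (φ z))
    {A : Matrix ι ι ℝ} (hA : A.transpose = -A) {v : ι → ℂ} {r : ℂ}
    (h : A.map Complex.ofReal *ᵥ v = r • v) :
    (realMatrixFun φ A).map Complex.ofReal *ᵥ v = φ r • v := by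
  rw [map_ofReal_realMatrixFun φ hφ A hA]
  exact cfc_mulVec_of_eigenvector (isStarNormal_map_ofReal_of_transpose_eq_neg hA) h φ

theorem vecMul_realMatrixFun_of_eigenvector {φ : ℂ → ℂ} (hφ : ∀ z, φ (star z) = star (φ z))
    {A : Matrix ι ι ℝ} (hA : A.transpose = -A) {v : ι → ℂ} {r : ℂ}
    (h : A.map Complex.ofReal *ᵥ v = r • v) :
    v ᵥ* (realMatrixFun φ A).map Complex.ofReal = φ (-r) • v := by
  obtain ⟨b, l, hb⟩ := exists_eigenbasis_of_transpose_eq_neg hA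
  have hv := vecMul_of_eigenvector hA h
  apply (dotProductEquiv ℂ ι).injective
  refine b.ext fun i => ?_
  simp only [dotProductEquiv_apply_apply]
  rw [← Matrix.dotProduct_mulVec, realMatrixFun_mulVec_of_eigenvector hφ hA (hb i),
    dotProduct_smul, smul_dotProduct, smul_eq_mul, smul_eq_mul]
  have h1 : l i * (v ⬝ᵥ b i) = -r * (v ⬝ᵥ b i) := by
    rw [← smul_eq_mul, ← dotProduct_smul, ← hb i, Matrix.dotProduct_mulVec, hv, smul_dotProduct,
      smul_eq_mul]
  rcases mul_eq_mul_right_iff.1 h1 with h2 | h2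
  · rw [h2]
  · rw [h2, mul_zero, mul_zero]

theorem realMatrixFun_expJacobianFun {A : Matrix ι ι ℝ} (hA : A.transpose = -A) :
    realMatrixFun expJacobianFun A = phiSeries 1 A := by
  obtain ⟨b, l, hb⟩ := exists_eigenbasis_of_transpose_eq_neg hA
  refine map_ofReal_injective (Matrix.ext_mulVec_basis b fun i => ?_)
  rw [realMatrixFun_mulVec_of_eigenvector expJacobianFun_star hA (hb i),
    phiSeries_map_mulVec_of_eigenvector (hb i), expJacobianFun_eq_phiSeries]

theorem phiSeries_ne_zero_of_det_ne_zero {A : Matrix ι ι ℝ} {k : ℕ} (h : (phiSeries k A).det ≠ 0)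
    {v : ι → ℂ} {r : ℂ} (hv : A.map Complex.ofReal *ᵥ v = r • v) (hv0 : v ≠ 0) :
    phiSeries k r ≠ 0 := by
  intro h0
  have h1 := phiSeries_map_mulVec_of_eigenvector hv k
  rw [h0, zero_smul] at h1
  have h2 : ((phiSeries k A).map Complex.ofReal).det = 0 :=
    Matrix.exists_mulVec_eq_zero_iff.1 ⟨v, hv0, h1⟩
  have h3 := (RingHom.map_det Complex.ofRealHom (phiSeries k A)).symm
  rw [RingHom.mapMatrix_apply] at h3
  exact h (Complex.ofReal_eq_zero.1 (h3.symm.trans h2))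

theorem realMatrixFun_dynamicalF_mul {A : Matrix ι ι ℝ} (hA : A.transpose = -A)
    (h : (phiSeries 1 A).det ≠ 0) :
    realMatrixFun dynamicalF A * phiSeries 1 A = (1 / 2 : ℝ) • phiSeries 1 A - phiSeries 2 A := by
  obtain ⟨b, l, hb⟩ := exists_eigenbasis_of_transpose_eq_neg hA
  refine map_ofReal_injective (Matrix.ext_mulVec_basis b fun i => ?_)
  have hne := phiSeries_ne_zero_of_det_ne_zero h (hb i) (b.ne_zero i)
  rw [map_ofReal_mul, ← Matrix.mulVec_mulVec, phiSeries_map_mulVec_of_eigenvector (hb i),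
    Matrix.mulVec_smul, realMatrixFun_mulVec_of_eigenvector dynamicalF_star hA (hb i),
    show ((1 / 2 : ℝ) • phiSeries 1 A - phiSeries 2 A).map Complex.ofReal =
      (1 / 2 : ℂ) • (phiSeries 1 A).map Complex.ofReal - (phiSeries 2 A).map Complex.ofReal by
      ext; simp,
    Matrix.sub_mulVec, Matrix.smul_mulVec, phiSeries_map_mulVec_of_eigenvector (hb i),
    phiSeries_map_mulVec_of_eigenvector (hb i), smul_smul, smul_smul, ← sub_smul,
    dynamicalF_eq_phiSeries hne]
  congr 1
  field_simp

/-- The matrix function `1/2 - φ₂(A) φ₁(A)⁻¹`, which agrees with `dynamicalF` on skew-symmetric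
matrices with `φ₁(A)` invertible. -/
noncomputable def dynamicalMatrix (A : Matrix ι ι ℝ) : Matrix ι ι ℝ :=
  (1 / 2 : ℝ) • 1 - phiSeries 2 A * Ring.inverse (phiSeries 1 A)

theorem dynamicalMatrix_mul {A : Matrix ι ι ℝ} (h : (phiSeries 1 A).det ≠ 0) :
    dynamicalMatrix A * phiSeries 1 A = (1 / 2 : ℝ) • phiSeries 1 A - phiSeries 2 A := by
  have hu : IsUnit (phiSeries 1 A) := (Matrix.isUnit_iff_isUnit_det _).2 h.isUnit
  rw [dynamicalMatrix, sub_mul, mul_assoc, Ring.inverse_mul_cancel _ hu, mul_one, smul_mul_assoc,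
    one_mul]

theorem realMatrixFun_dynamicalF {A : Matrix ι ι ℝ} (hA : A.transpose = -A)
    (h : (phiSeries 1 A).det ≠ 0) : realMatrixFun dynamicalF A = dynamicalMatrix A := by
  have hu : IsUnit (phiSeries 1 A) := (Matrix.isUnit_iff_isUnit_det _).2 h.isUnit
  exact hu.mul_left_injective
    ((realMatrixFun_dynamicalF_mul hA h).trans (dynamicalMatrix_mul h).symm)

theorem contDiffAt_dynamicalMatrix {n : WithTop ℕ∞} {A : Matrix ι ι ℝ}
    (h : (phiSeries 1 A).det ≠ 0) : ContDiffAt ℝ n (dynamicalMatrix : _ → Matrix ι ι ℝ) A := by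
  have hu : IsUnit (phiSeries 1 A) := (Matrix.isUnit_iff_isUnit_det _).2 h.isUnit
  obtain ⟨u, hu⟩ := hu
  have h1 : ContDiffAt ℝ n (Ring.inverse : Matrix ι ι ℝ → _) (phiSeries 1 A) := by
    rw [← hu]; exact contDiffAt_ringInverse ℝ u
  have h2 := h1.comp A (contDiff_phiSeries 1).contDiffAt
  exact contDiffAt_const.sub ((contDiff_phiSeries 2).contDiffAt.mul h2)

theorem eventually_det_phiSeries_ne_zero {E : Type*} [TopologicalSpace E]
    {f : E → Matrix ι ι ℝ} {x : E} (hf : ContinuousAt f x) (k : ℕ)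
    (h : (phiSeries k (f x)).det ≠ 0) : ∀ᶠ y in 𝓝 x, (phiSeries k (f y)).det ≠ 0 := by
  have h1 : Continuous fun A : Matrix ι ι ℝ => (phiSeries k A).det :=
    (contDiff_phiSeries (n := 0) k).continuous.matrix_det
  exact (h1.continuousAt.comp hf).eventually_ne h

/-- The derivative of `dynamicalMatrix` between a left and a right eigenvector. -/
theorem exists_hasDerivAt_dynamicalMatrix [Nonempty ι] {A : Matrix ι ι ℝ} (X : Matrix ι ι ℝ)
    (hA : A.transpose = -A) (h : (phiSeries 1 A).det ≠ 0) :
    ∃ S : Matrix ι ι ℝ, HasDerivAt (fun t : ℝ => dynamicalMatrix (A + t • X)) S 0 ∧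
      ∀ (y z : ι → ℂ) (l r : ℂ), A.map Complex.ofReal *ᵥ y = l • y →
        A.map Complex.ofReal *ᵥ z = r • z →
        sandwich y z S = dynamicalFDiff (-l) r * sandwich y z X := by
  obtain ⟨d₁, hs₁, hd₁⟩ := hasDerivAt_phiSeries_line 1 A X
  obtain ⟨d₂, hs₂, hd₂⟩ := hasDerivAt_phiSeries_line 2 A X
  have hline : ContDiff ℝ 1 fun t : ℝ => A + t • X :=
    contDiff_const.add (contDiff_id.smul contDiff_const)
  have hT : DifferentiableAt ℝ (fun t : ℝ => dynamicalMatrix (A + t • X)) 0 := by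
    have h1 : ContDiffAt ℝ 1 (dynamicalMatrix : _ → Matrix ι ι ℝ) (A + (0 : ℝ) • X) :=
      contDiffAt_dynamicalMatrix (by simpa using h)
    exact (h1.comp (0 : ℝ) hline.contDiffAt).differentiableAt one_ne_zero
  refine ⟨_, hT.hasDerivAt, fun y z l r hy hz => ?_⟩
  by_cases hy0 : y = 0
  · simp [hy0, sandwich_apply]
  by_cases hz0 : z = 0
  · simp [hz0, sandwich_apply]
  set S := deriv (fun t : ℝ => dynamicalMatrix (A + t • X)) 0
  have hev : ∀ᶠ t : ℝ in 𝓝 0, dynamicalMatrix (A + t • X) * phiSeries 1 (A + t • X) =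
      (1 / 2 : ℝ) • phiSeries 1 (A + t • X) - phiSeries 2 (A + t • X) :=
    (eventually_det_phiSeries_ne_zero hline.continuous.continuousAt 1 (by simpa using h)).mono
      fun t ht => dynamicalMatrix_mul ht
  have h1 := (hT.hasDerivAt.mul hd₁).unique
    (((hd₁.const_smul (1 / 2 : ℝ)).sub hd₂).congr_of_eventuallyEq hev)
  simp only [zero_smul, add_zero] at h1
  have hy' := vecMul_of_eigenvector hA hy
  have hr : phiSeries 1 r ≠ 0 := phiSeries_ne_zero_of_det_ne_zero h hz hz0
  have hl : phiSeries 1 (-l) ≠ 0 :=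
    phiSeries_one_neg (phiSeries_ne_zero_of_det_ne_zero h hy hy0)
  have hTt : y ᵥ* (dynamicalMatrix A).map Complex.ofReal = dynamicalF (-l) • y := by
    rw [← realMatrixFun_dynamicalF hA h]
    exact vecMul_realMatrixFun_of_eigenvector dynamicalF_star hA hy
  have h2 := congrArg (sandwich y z) h1
  rw [map_add, map_sub, map_smul, sandwich_mul, sandwich_mul', hTt, sandwich_smul_left,
    phiSeries_map_mulVec_of_eigenvector hz, sandwich_smul_right,
    sandwich_phiSeries_deriv hy' hz hs₁, sandwich_phiSeries_deriv hy' hz hs₂,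
    Complex.real_smul] at h2
  push_cast at h2
  have h3 := dynamicalFDiff_mul hl hr
  apply mul_left_cancel₀ hr
  linear_combination h2 - sandwich y z X * h3

end MatrixCalculus

section Trilinear

open Matrix

variable {ι : Type*} [Fintype ι]

/-- The complex trilinear form with the real coefficients `K a b c`. -/
noncomputable def trilinearForm (K : ι → ι → ι → ℝ) (x y z : ι → ℂ) : ℂ :=
  ∑ a, ∑ b, ∑ c, x a * y b * z c * (K a b c : ℂ)

theorem trilinearForm_eq_sum_first (K : ι → ι → ι → ℝ) (x y z : ι → ℂ) :
    trilinearForm K x y z = ∑ a, x a * sandwich y z (Matrix.of (K a)) := by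
  simp only [trilinearForm, sandwich_apply, dotProduct, Matrix.mulVec, Finset.mul_sum,
    Matrix.map_apply, Matrix.of_apply]
  refine Finset.sum_congr rfl fun a _ => Finset.sum_congr rfl fun b _ =>
    Finset.sum_congr rfl fun c _ => by ring

theorem trilinearForm_eq_sum_second (K : ι → ι → ι → ℝ) (x y z : ι → ℂ) :
    trilinearForm K x y z = ∑ b, y b * sandwich x z (Matrix.of fun a c => K a b c) := by
  rw [trilinearForm, Finset.sum_comm]
  simp only [sandwich_apply, dotProduct, Matrix.mulVec, Finset.mul_sum,
    Matrix.map_apply, Matrix.of_apply]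
  refine Finset.sum_congr rfl fun a _ => Finset.sum_congr rfl fun b _ =>
    Finset.sum_congr rfl fun c _ => by ring

theorem trilinearForm_rotate (K : ι → ι → ι → ℝ) (x y z : ι → ℂ) :
    trilinearForm (fun a b c => K b c a) x y z = trilinearForm K y z x := by
  rw [trilinearForm, trilinearForm, Finset.sum_comm]
  refine Finset.sum_congr rfl fun b _ => ?_
  rw [Finset.sum_comm]
  refine Finset.sum_congr rfl fun c _ => Finset.sum_congr rfl fun a _ => by ring

theorem trilinearForm_add (K L : ι → ι → ι → ℝ) (x y z : ι → ℂ) :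
    trilinearForm (fun a b c => K a b c + L a b c) x y z =
      trilinearForm K x y z + trilinearForm L x y z := by
  simp only [trilinearForm, Complex.ofReal_add, mul_add, Finset.sum_add_distrib]

theorem trilinearForm_mul (r : ℝ) (K : ι → ι → ι → ℝ) (x y z : ι → ℂ) :
    trilinearForm (fun a b c => r * K a b c) x y z = r * trilinearForm K x y z := by
  simp only [trilinearForm, Finset.mul_sum]
  refine Finset.sum_congr rfl fun a _ => Finset.sum_congr rfl fun b _ =>
    Finset.sum_congr rfl fun c _ => by push_cast; ring

theorem trilinearForm_cyclicSum (K : ι → ι → ι → ℝ) (x y z : ι → ℂ) :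
    trilinearForm (cyclicSum K) x y z =
      trilinearForm K x y z + trilinearForm K y z x + trilinearForm K z x y := by
  rw [← trilinearForm_rotate K x y z, ← trilinearForm_rotate K y z x,
    ← trilinearForm_rotate (fun a b c => K b c a) x y z, ← trilinearForm_add, ← trilinearForm_add]
  rfl

/-- `trilinearForm` as a trilinear map. -/
noncomputable def trilinearMap (K : ι → ι → ι → ℝ) :
    (ι → ℂ) →ₗ[ℂ] (ι → ℂ) →ₗ[ℂ] (ι → ℂ) →ₗ[ℂ] ℂ :=
  ∑ a, ∑ b, ∑ c, (K a b c : ℂ) •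
    (LinearMap.proj a : (ι → ℂ) →ₗ[ℂ] ℂ).smulRight
      ((LinearMap.proj b : (ι → ℂ) →ₗ[ℂ] ℂ).smulRight (LinearMap.proj c : (ι → ℂ) →ₗ[ℂ] ℂ))

theorem trilinearMap_apply (K : ι → ι → ι → ℝ) (x y z : ι → ℂ) :
    trilinearMap K x y z = trilinearForm K x y z := by
  simp only [trilinearMap, trilinearForm, LinearMap.sum_apply, LinearMap.smul_apply,
    LinearMap.smulRight_apply, LinearMap.proj_apply, smul_eq_mul]
  refine Finset.sum_congr rfl fun a _ => Finset.sum_congr rfl fun b _ =>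
    Finset.sum_congr rfl fun c _ => by ring

theorem eq_of_trilinearForm_basis_eq {κ : Type*} (v : Module.Basis κ ℂ (ι → ℂ))
    {K L : ι → ι → ι → ℝ}
    (h : ∀ i j k, trilinearForm K (v i) (v j) (v k) = trilinearForm L (v i) (v j) (v k)) :
    K = L := by
  classical
  have h1 : trilinearMap K = trilinearMap L :=
    v.ext fun i => v.ext fun j => v.ext fun k => by
      simpa only [trilinearMap_apply] using h i j k
  funext a b c
  have h2 : trilinearForm K (Pi.single a 1) (Pi.single b 1) (Pi.single c 1) =
      trilinearForm L (Pi.single a 1) (Pi.single b 1) (Pi.single c 1) := by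
    rw [← trilinearMap_apply, h1, trilinearMap_apply]
  simpa [trilinearForm, Pi.single_apply, Finset.sum_ite_eq] using h2

end Trilinear

section AdjointMatrix

theorem structConst_swap {𝔤 ι : Type*} [LieRing 𝔤] [LieAlgebra ℝ 𝔤] (e : Module.Basis ι ℝ 𝔤) (a b c : ι) :
    structConst e b a c = -structConst e a b c := by
  rw [structConst, structConst, ← lie_skew, map_neg, Finsupp.neg_apply]

open Matrix

variable {𝔤 : Type*} [LieRing 𝔤] [LieAlgebra ℝ 𝔤] {ι : Type*} [Fintype ι] [DecidableEq ι]

/-- The matrix of `ad x` in the basis `e`. -/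
noncomputable def adMatrix (e : Module.Basis ι ℝ 𝔤) : 𝔤 →ₗ[ℝ] Matrix ι ι ℝ :=
  (LinearMap.toMatrix e e).toLinearMap ∘ₗ (LieModule.toEnd ℝ 𝔤 𝔤 : 𝔤 →ₗ[ℝ] Module.End ℝ 𝔤)

theorem adMatrix_eq (e : Module.Basis ι ℝ 𝔤) (x : 𝔤) :
    adMatrix e x = LinearMap.toMatrix e e (LieAlgebra.ad ℝ 𝔤 x) := rfl

theorem adMatrix_apply (e : Module.Basis ι ℝ 𝔤) (x : 𝔤) (a b : ι) :
    adMatrix e x a b = e.repr ⁅x, e b⁆ a := by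
  rw [adMatrix_eq, LinearMap.toMatrix_apply, LieAlgebra.ad_apply]

theorem adMatrix_basis_apply (e : Module.Basis ι ℝ 𝔤) (a b c : ι) :
    adMatrix e (e a) c b = structConst e a b c := adMatrix_apply e _ _ _

theorem adMatrix_lie (e : Module.Basis ι ℝ 𝔤) (x y : 𝔤) :
    adMatrix e ⁅x, y⁆ = adMatrix e x * adMatrix e y - adMatrix e y * adMatrix e x := by
  have h : LieAlgebra.ad ℝ 𝔤 ⁅x, y⁆ = LieAlgebra.ad ℝ 𝔤 x * LieAlgebra.ad ℝ 𝔤 y -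
      LieAlgebra.ad ℝ 𝔤 y * LieAlgebra.ad ℝ 𝔤 x := by
    ext z
    simp
  rw [adMatrix_eq, h, map_sub, LinearMap.toMatrix_mul, LinearMap.toMatrix_mul]
  rfl

theorem sum_adMatrix_smul (e : Module.Basis ι ℝ 𝔤) (x : 𝔤) (b : ι) :
    ∑ d, adMatrix e x d b • adMatrix e (e d) =
      adMatrix e x * adMatrix e (e b) - adMatrix e (e b) * adMatrix e x := by
  rw [← adMatrix_lie]
  conv_rhs => rw [← e.sum_repr ⁅x, e b⁆]
  simp only [map_sum, map_smul, adMatrix_apply]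

variable {B : LinearMap.BilinForm ℝ 𝔤} {e : Module.Basis ι ℝ 𝔤}

theorem repr_eq_of_orthonormal (he : ∀ a b : ι, B (e a) (e b) = if a = b then 1 else 0) (x : 𝔤)
    (a : ι) : e.repr x a = B x (e a) := by
  conv_rhs => rw [← e.sum_repr x]
  rw [map_sum, LinearMap.sum_apply]
  simp only [map_smul, LinearMap.smul_apply, he, smul_eq_mul, mul_ite, mul_one, mul_zero,
    Finset.sum_ite_eq', Finset.mem_univ, if_true]

theorem transpose_adMatrix (hB : IsInvariantInnerProduct B)
    (he : ∀ a b : ι, B (e a) (e b) = if a = b then 1 else 0) (x : 𝔤) :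
    (adMatrix e x).transpose = -adMatrix e x := by
  ext a b
  rw [Matrix.transpose_apply, Matrix.neg_apply, adMatrix_apply, adMatrix_apply,
    repr_eq_of_orthonormal he, repr_eq_of_orthonormal he, hB.invariant, hB.symm.eq]

theorem structConst_swap_right (hB : IsInvariantInnerProduct B)
    (he : ∀ a b : ι, B (e a) (e b) = if a = b then 1 else 0) (a b c : ι) :
    structConst e a c b = -structConst e a b c := by
  have := congrFun (congrFun (transpose_adMatrix hB he (e a)) c) b
  rw [Matrix.transpose_apply, Matrix.neg_apply, adMatrix_basis_apply, adMatrix_basis_apply] at this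
  exact this

theorem structConst_rotate (hB : IsInvariantInnerProduct B)
    (he : ∀ a b : ι, B (e a) (e b) = if a = b then 1 else 0) (a b c : ι) :
    structConst e b c a = structConst e a b c := by
  rw [structConst_swap_right hB he b a c, structConst_swap, neg_neg]

theorem trilinearForm_structConst_rotate (hB : IsInvariantInnerProduct B)
    (he : ∀ a b : ι, B (e a) (e b) = if a = b then 1 else 0) (x y z : ι → ℂ) :
    trilinearForm (structConst e) y z x = trilinearForm (structConst e) x y z := by
  rw [← trilinearForm_rotate]
  congr 1
  funext a b c
  exact structConst_rotate hB he a b c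

theorem trilinearForm_structConst_eq_first (hB : IsInvariantInnerProduct B)
    (he : ∀ a b : ι, B (e a) (e b) = if a = b then 1 else 0) (x y z : ι → ℂ) :
    ∑ a, x a * sandwich y z (adMatrix e (e a)) = -trilinearForm (structConst e) x y z := by
  rw [trilinearForm_eq_sum_first, ← Finset.sum_neg_distrib]
  refine Finset.sum_congr rfl fun a _ => ?_
  rw [show adMatrix e (e a) = -Matrix.of (structConst e a) from ?_, map_neg, mul_neg]
  ext b c
  rw [adMatrix_basis_apply, structConst_swap_right hB he]
  rfl

theorem trilinearForm_structConst_eq_second (hB : IsInvariantInnerProduct B)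
    (he : ∀ a b : ι, B (e a) (e b) = if a = b then 1 else 0) (x y z : ι → ℂ) :
    ∑ b, y b * sandwich x z (adMatrix e (e b)) = trilinearForm (structConst e) x y z := by
  rw [trilinearForm_eq_sum_second]
  refine Finset.sum_congr rfl fun b _ => ?_
  congr 2
  ext a c
  rw [adMatrix_basis_apply, structConst_rotate hB he]
  rfl

theorem add_eq_zero_or_trilinearForm_structConst_eq_zero (hB : IsInvariantInnerProduct B)
    (he : ∀ a b : ι, B (e a) (e b) = if a = b then 1 else 0) {μ : 𝔤} {x y z : ι → ℂ} {α β γ : ℂ}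
    (hx : (adMatrix e μ).map Complex.ofReal *ᵥ x = α • x)
    (hy : (adMatrix e μ).map Complex.ofReal *ᵥ y = β • y)
    (hz : (adMatrix e μ).map Complex.ofReal *ᵥ z = γ • z) :
    α + β + γ = 0 ∨ trilinearForm (structConst e) x y z = 0 := by
  rw [← mul_eq_zero, ← trilinearForm_structConst_eq_second hB he]
  have hx' := vecMul_of_eigenvector (transpose_adMatrix hB he μ) hx
  have h1 : ∀ b, ∑ d, (adMatrix e μ d b : ℂ) * sandwich x z (adMatrix e (e d)) =
      (-α - γ) * sandwich x z (adMatrix e (e b)) := by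
    intro b
    have h := congrArg (sandwich x z) (sum_adMatrix_smul e μ b)
    rw [map_sub, sandwich_mul', hx', sandwich_smul_left, sandwich_mul, hz, sandwich_smul_right,
      map_sum] at h
    simp only [map_smul, Complex.real_smul] at h
    rw [h]; ring
  have h2 : ∑ b, y b * ∑ d, (adMatrix e μ d b : ℂ) * sandwich x z (adMatrix e (e d)) =
      ∑ d, (β * y d) * sandwich x z (adMatrix e (e d)) := by
    simp only [Finset.mul_sum]
    rw [Finset.sum_comm]
    refine Finset.sum_congr rfl fun d _ => ?_
    have h3 := congrFun hy d
    simp only [Matrix.mulVec, dotProduct, Matrix.map_apply, Pi.smul_apply, smul_eq_mul] at h3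
    rw [← h3, Finset.sum_mul]
    exact Finset.sum_congr rfl fun b _ => by ring
  simp only [h1] at h2
  have h4 : ∑ b, y b * ((-α - γ) * sandwich x z (adMatrix e (e b))) =
      (-α - γ) * ∑ b, y b * sandwich x z (adMatrix e (e b)) := by
    rw [Finset.mul_sum]; exact Finset.sum_congr rfl fun b _ => by ring
  have h5 : ∑ d, (β * y d) * sandwich x z (adMatrix e (e d)) =
      β * ∑ b, y b * sandwich x z (adMatrix e (e b)) := by
    rw [Finset.mul_sum]; exact Finset.sum_congr rfl fun b _ => by ring
  rw [h4, h5] at h2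
  linear_combination -h2

end AdjointMatrix

section DynamicalYangBaxter

open Matrix
open scoped Matrix.Norms.L2Operator

variable {𝔤 : Type*} [LieRing 𝔤] [LieAlgebra ℝ 𝔤] {ι : Type*} [Fintype ι] [DecidableEq ι]
  {B : LinearMap.BilinForm ℝ 𝔤} {e : Module.Basis ι ℝ 𝔤}

theorem expJacobian_eq_det_phiSeries (hB : IsInvariantInnerProduct B)
    (he : ∀ a b : ι, B (e a) (e b) = if a = b then 1 else 0) (μ : 𝔤) :
    expJacobian e μ = (phiSeries 1 (adMatrix e μ)).det := by
  rw [expJacobian, adFun, ← adMatrix_eq, realMatrixFun_expJacobianFun (transpose_adMatrix hB he μ)]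

theorem adFun_dynamicalF_eq (hB : IsInvariantInnerProduct B)
    (he : ∀ a b : ι, B (e a) (e b) = if a = b then 1 else 0) {μ : 𝔤}
    (hμ : (phiSeries 1 (adMatrix e μ)).det ≠ 0) :
    adFun dynamicalF e μ = dynamicalMatrix (adMatrix e μ) := by
  rw [adFun, ← adMatrix_eq, realMatrixFun_dynamicalF (transpose_adMatrix hB he μ) hμ]

theorem contDiffAt_dynamicalT (hB : IsInvariantInnerProduct B)
    (he : ∀ a b : ι, B (e a) (e b) = if a = b then 1 else 0) {μ : 𝔤} (hμ : μ ∈ expRegularSet e)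
    (n : WithTop ℕ∞) (b c : ι) :
    ContDiffAt ℝ n (fun x : ι → ℝ => dynamicalT e b c (e.equivFun.symm x)) (e.equivFun μ) := by
  set L : (ι → ℝ) →ₗ[ℝ] Matrix ι ι ℝ := adMatrix e ∘ₗ e.equivFun.symm.toLinearMap with hL
  have hLd : ContDiff ℝ n L := (LinearMap.toContinuousLinearMap L).contDiff
  have hdet : (phiSeries 1 (L (e.equivFun μ))).det ≠ 0 := by
    simpa [hL, ← expJacobian_eq_det_phiSeries hB he] using! hμ
  have hT : ContDiffAt ℝ n (fun x => dynamicalMatrix (L x)) (e.equivFun μ) :=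
    (contDiffAt_dynamicalMatrix hdet).comp _ hLd.contDiffAt
  have hE : ContDiff ℝ n (Matrix.entryLinearMap ℝ ℝ b c : Matrix ι ι ℝ →ₗ[ℝ] ℝ) :=
    (LinearMap.toContinuousLinearMap (Matrix.entryLinearMap ℝ ℝ b c)).contDiff
  refine (hE.contDiffAt.comp _ hT).congr_of_eventuallyEq ?_
  filter_upwards [eventually_det_phiSeries_ne_zero hLd.continuous.continuousAt 1 hdet] with x hx
  exact congrFun (congrFun (adFun_dynamicalF_eq hB he hx) b) c

theorem partialDeriv_dynamicalT (hB : IsInvariantInnerProduct B)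
    (he : ∀ a b : ι, B (e a) (e b) = if a = b then 1 else 0) {μ : 𝔤}
    (hμ : (phiSeries 1 (adMatrix e μ)).det ≠ 0) {a : ι} {S : Matrix ι ι ℝ}
    (hS : HasDerivAt (fun t : ℝ => dynamicalMatrix (adMatrix e μ + t • adMatrix e (e a))) S 0)
    (b c : ι) : partialDeriv e a (dynamicalT e b c) μ = S b c := by
  have hE := (LinearMap.toContinuousLinearMap
    (Matrix.entryLinearMap ℝ ℝ b c : Matrix ι ι ℝ →ₗ[ℝ] ℝ)).hasFDerivAt.comp_hasDerivAt 0 hS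
  rw [partialDeriv, lineDeriv]
  refine (hE.congr_of_eventuallyEq ?_).deriv
  have hline : Continuous fun t : ℝ => adMatrix e μ + t • adMatrix e (e a) := by fun_prop
  filter_upwards [eventually_det_phiSeries_ne_zero hline.continuousAt 1
    (x := (0 : ℝ)) (by simpa using hμ)] with t ht
  rw [← map_smul, ← map_add] at ht
  have h := congrFun (congrFun (adFun_dynamicalF_eq hB he ht) b) c
  rw [map_add, map_smul] at h
  exact h

theorem cyclicSum_dynamicalT (hB : IsInvariantInnerProduct B)
    (he : ∀ a b : ι, B (e a) (e b) = if a = b then 1 else 0) {μ : 𝔤} (hμ : μ ∈ expRegularSet e)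
    (a₀ b₀ c₀ : ι) :
    cyclicSum (fun a b c : ι => partialDeriv e a (dynamicalT e b c) μ +
        ∑ r : ι, ∑ s : ι, dynamicalT e a r μ * structConst e r b s * dynamicalT e s c μ) a₀ b₀ c₀ =
      1 / 4 * structConst e a₀ b₀ c₀ := by
  have : Nonempty ι := ⟨a₀⟩
  have hA := transpose_adMatrix hB he μ
  have hdet : (phiSeries 1 (adMatrix e μ)).det ≠ 0 := expJacobian_eq_det_phiSeries hB he μ ▸ hμ
  choose S hS hSs using fun a =>
    exists_hasDerivAt_dynamicalMatrix (adMatrix e (e a)) hA hdet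
  have hTT : ∀ a b c : ι, ∑ r : ι, ∑ s : ι,
      dynamicalT e a r μ * structConst e r b s * dynamicalT e s c μ =
      (adFun dynamicalF e μ * (adMatrix e (e b) * adFun dynamicalF e μ)) a c := by
    intro a b c
    simp only [Matrix.mul_apply, Finset.mul_sum, adMatrix_basis_apply]
    refine Finset.sum_congr rfl fun r _ => Finset.sum_congr rfl fun s _ => ?_
    rw [← structConst_rotate hB he r b s, mul_assoc]
    rfl
  have hK : (fun a b c : ι => partialDeriv e a (dynamicalT e b c) μ +
      ∑ r : ι, ∑ s : ι, dynamicalT e a r μ * structConst e r b s * dynamicalT e s c μ) =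
      fun a b c => S a b c +
        (adFun dynamicalF e μ * (adMatrix e (e b) * adFun dynamicalF e μ)) a c := by
    funext a b c
    rw [hTT, partialDeriv_dynamicalT hB he hdet (hS a)]
  rw [hK]
  obtain ⟨v, l, hv⟩ := exists_eigenbasis_of_transpose_eq_neg hA
  have hl : ∀ i, phiSeries 1 (l i) ≠ 0 := fun i =>
    phiSeries_ne_zero_of_det_ne_zero hdet (hv i) (v.ne_zero i)
  have hform : ∀ i j k, trilinearForm (fun a b c => S a b c +
      (adFun dynamicalF e μ * (adMatrix e (e b) * adFun dynamicalF e μ)) a c) (v i) (v j) (v k) =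
      -(dynamicalFDiff (-l j) (l k) + dynamicalF (l i) * dynamicalF (l k)) *
        trilinearForm (structConst e) (v i) (v j) (v k) := by
    intro i j k
    refine (trilinearForm_add (fun a b c => S a b c) (fun a b c =>
      (adFun dynamicalF e μ * (adMatrix e (e b) * adFun dynamicalF e μ)) a c) _ _ _).trans ?_
    rw [trilinearForm_eq_sum_first, trilinearForm_eq_sum_second]
    have h1 : ∀ a, sandwich (v j) (v k) (Matrix.of (S a)) = dynamicalFDiff (-l j) (l k) *
        sandwich (v j) (v k) (adMatrix e (e a)) := fun a => hSs a _ _ _ _ (hv j) (hv k)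
    have h2 : ∀ b, sandwich (v i) (v k) (Matrix.of fun a c =>
        (adFun dynamicalF e μ * (adMatrix e (e b) * adFun dynamicalF e μ)) a c) =
        -(dynamicalF (l i) * dynamicalF (l k)) * sandwich (v i) (v k) (adMatrix e (e b)) := by
      intro b
      change sandwich (v i) (v k)
        (adFun dynamicalF e μ * (adMatrix e (e b) * adFun dynamicalF e μ)) = _
      rw [sandwich_mul', adFun, ← adMatrix_eq,
        vecMul_realMatrixFun_of_eigenvector dynamicalF_star hA (hv i), sandwich_smul_left,
        sandwich_mul, realMatrixFun_mulVec_of_eigenvector dynamicalF_star hA (hv k),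
        sandwich_smul_right, dynamicalF_neg]
      ring
    simp only [h1, h2, mul_left_comm (v i _), mul_left_comm (v j _), ← Finset.mul_sum]
    rw [trilinearForm_structConst_eq_first hB he, trilinearForm_structConst_eq_second hB he]
    ring
  refine congrFun (congrFun (congrFun (eq_of_trilinearForm_basis_eq v
    (K := cyclicSum _) (L := fun a b c => 1 / 4 * structConst e a b c) fun i j k => ?_) a₀) b₀) c₀
  rw [trilinearForm_cyclicSum, trilinearForm_mul]
  refine (congrArg₂ (· + ·) (congrArg₂ (· + ·) (hform i j k) (hform j k i)) (hform k i j)).trans ?_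
  rw [← trilinearForm_structConst_rotate hB he (v k) (v i) (v j),
    trilinearForm_structConst_rotate hB he (v i) (v j) (v k)]
  rcases add_eq_zero_or_trilinearForm_structConst_eq_zero hB he (hv i) (hv j) (hv k) with h | h
  · have := cyclic_dynamicalFDiff h (hl i) (hl j) (hl k)
    push_cast
    linear_combination -trilinearForm (structConst e) (v i) (v j) (v k) * this
  · rw [h]; simp

end DynamicalYangBaxter

theorem mainTheorem7 {𝔤 : Type*} [LieRing 𝔤] [LieAlgebra ℝ 𝔤]
    (B : LinearMap.BilinForm ℝ 𝔤) (hB : IsInvariantInnerProduct B)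
    {ι : Type*} [Fintype ι] [DecidableEq ι] (e : Module.Basis ι ℝ 𝔤)
    (he : ∀ a b : ι, B (e a) (e b) = if a = b then 1 else 0)
    (μ : 𝔤) (hμ : μ ∈ expRegularSet e) :
    (∀ b c : ι, ContDiffAt ℝ (⊤ : ℕ∞)
      (fun x : ι → ℝ => dynamicalT e b c (e.equivFun.symm x)) (e.equivFun μ)) ∧
    ∀ a b c : ι,
      cyclicSum (fun a b c : ι => partialDeriv e a (dynamicalT e b c) μ +
        ∑ r : ι, ∑ s : ι, dynamicalT e a r μ * structConst e r b s * dynamicalT e s c μ) a b c =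
      1 / 4 * structConst e a b c := by
  exact ⟨contDiffAt_dynamicalT hB he hμ _, cyclicSum_dynamicalT hB he hμ⟩
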